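/- Let $q$ be a prime power and let $\mathbb F_{q^2}(x,y)$, with $y^q+y=x^{q+1}$, be the function field of the Hermitian curve $\mathcal H_q\colon Y^q+Y=X^{q+1}$ over $\mathbb F_{q^2}$. Let $O=(0,0)$ and let $Y_\infty=(0:1:0)$ be the unique point at infinity of $\mathcal H_q$. The chord $OY_\infty$, that is, the line $X=0$, contains exactly $q-1$ points $Q_1,\dots,Q_{q-1}$ of $\mathcal H_q$ other than $O$ and $Y_\infty$, all of them $\mathbb F_{q^2}$-rational. For an integer $m$ with $2\le m\le q-1$ let $\mathtt G=m(Q_1+\dots+Q_{q-1})$, and let $$\mathcal L(\mathtt G)=\{f\in\mathbb F_{q^2}(x,y) : f=0 \text{ or } \operatorname{div}(f)+\mathtt G\ge 0\}$$ be its Riemann–Roch space over $\mathbb F_{q^2}$. Then $$\mathcal L(\mathtt G)=\Bigl\{\frac{y\,g(x,y)+\varepsilon x^m}{x^m} : g\in\mathbb F_{q^2}[X,Y],\ \deg g\le m-2,\ \varepsilon\in\mathbb F_{q^2}\Bigr\},$$ where $\deg g$ is the total degree (and $g=0$ is allowed). Moreover $\deg(\mathtt G)=m(q-1)$ and $\dim_{\mathbb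 F_{q^2}}\mathcal L(\mathtt G)=\tfrac12 m(m-1)+1$. -/

import Mathlib

noncomputable section

open Polynomial

/-! ### Places, divisors and Riemann–Roch spaces of a field extension `F / K` -/

/-- A place of `F / K`, given by its valuation ring: a discrete valuation ring of `F`
(in particular a proper subring with fraction field `F`) that contains `K`. In a function
field of one variable every valuation ring `O` with `K ⊆ O ⊊ F` is of this kind. -/
structure Place (K F : Type*) [Field K] [Field F] [Algebra K F] where
  /-- The valuation ring of the place. -/
  ring : ValuationSubring F
  algebraMap_mem : ∀ a : K, algebraMap K F a ∈ ring
  isDVR : IsDiscreteValuationRing ring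

namespace Place

variable {K F : Type*} [Field K] [Field F] [Algebra K F] (P : Place K F)

instance : IsDiscreteValuationRing P.ring := P.isDVR

instance : Algebra K P.ring :=
  ((algebraMap K F).codRestrict P.ring P.algebraMap_mem).toAlgebra

/-- The valuation of a place in Mathlib's multiplicative form. -/
def valuation : Valuation F (WithZero (Multiplicative ℤ)) :=
  (IsDiscreteValuationRing.maximalIdeal P.ring).valuation F

/-- The order `v_P(f)` of a function at a place (normalised, additive). Only meaningful
for `f ≠ 0`; it takes the value `0` at `f = 0`. -/
def ord (f : F) : ℤ := -WithZero.log (P.valuation f)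

/-- The degree of a place: the degree of its residue field over `K`. -/
def degree : ℕ := Module.finrank K (IsLocalRing.ResidueField P.ring)

end Place

/-- Divisors of `F / K`: formal integral combinations of places. -/
abbrev Divisor (K F : Type*) [Field K] [Field F] [Algebra K F] := Place K F →₀ ℤ

/-- The degree of a divisor. -/
def Divisor.degree {K F : Type*} [Field K] [Field F] [Algebra K F] (G : Divisor K F) : ℤ :=
  G.sum fun P n => n * (P.degree : ℤ)

theorem Place.zero_le_ord_add_iff {K F : Type*} [Field K] [Field F] [Algebra K F]
    (P : Place K F) {f : F} (hf : f ≠ 0) (n : ℤ) :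
    0 ≤ P.ord f + n ↔ P.valuation f ≤ WithZero.exp n := by
  rw [← WithZero.log_le_iff_le_exp ((Valuation.ne_zero_iff _).2 hf), Place.ord]
  constructor <;> intro h <;> linarith

/-- The Riemann–Roch space `L(G)`: the functions `f` with `f = 0` or `div f + G ≥ 0`. -/
def riemannRochSpace {K F : Type*} [Field K] [Field F] [Algebra K F] (G : Divisor K F) :
    Submodule K F where
  carrier := {f | f = 0 ∨ ∀ P : Place K F, 0 ≤ P.ord f + G P}
  zero_mem' := Or.inl rfl
  add_mem' := by
    intro f g hf hg
    by_cases hf0 : f = 0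
    · simpa [hf0] using hg
    by_cases hg0 : g = 0
    · simpa [hg0] using hf
    by_cases hfg : f + g = 0
    · exact Or.inl hfg
    refine Or.inr fun P => ?_
    rw [P.zero_le_ord_add_iff hfg]
    refine P.valuation.map_add_le ?_ ?_
    · exact (P.zero_le_ord_add_iff hf0 _).1 ((hf.resolve_left hf0) P)
    · exact (P.zero_le_ord_add_iff hg0 _).1 ((hg.resolve_left hg0) P)
  smul_mem' := by
    intro c f hf
    by_cases hcf : c • f = 0
    · exact Or.inl hcf
    have hf0 : f ≠ 0 := fun h => hcf (by simp [h])
    refine Or.inr fun P => ?_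
    rw [P.zero_le_ord_add_iff hcf, Algebra.smul_def, map_mul]
    have h1 := (P.zero_le_ord_add_iff hf0 _).1 ((hf.resolve_left hf0) P)
    have h2 : P.valuation (algebraMap K F c) ≤ 1 :=
      (IsDiscreteValuationRing.maximalIdeal P.ring).valuation_le_one
        (⟨algebraMap K F c, P.algebraMap_mem c⟩ : P.ring)
    exact (mul_le_mul' h2 h1).trans_eq (one_mul _)

/-! ### The Hermitian curve `Y ^ q + Y = X ^ (q + 1)` over the field `K` with `q ^ 2` elements -/

namespace Hermitian

/-- The equation of the Hermitian curve, as a polynomial in the variable `X` with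
coefficients in `K[Y]`. The outer variable is `X`, the inner variable is `Y`. -/
def equation (K : Type*) [Field K] (q : ℕ) : K[X][X] :=
  X ^ (q + 1) - C (X ^ q + X)

/-- The affine coordinate ring `K[X, Y] / (Y ^ q + Y - X ^ (q + 1))`. -/
abbrev CoordinateRing (K : Type*) [Field K] (q : ℕ) := AdjoinRoot (equation K q)

section

variable (K : Type*) [Field K] (q : ℕ)

/-- The class of `X` in the coordinate ring. -/
def xR : CoordinateRing K q := AdjoinRoot.root (equation K q)

/-- The class of `Y` in the coordinate ring. -/
def yR : CoordinateRing K q := AdjoinRoot.of (equation K q) X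

theorem equation_xR_yR : yR K q ^ q + yR K q = xR K q ^ (q + 1) := by
  have h : AdjoinRoot.mk (equation K q) (X ^ (q + 1) - C (X ^ q + X)) = 0 := AdjoinRoot.mk_self
  rw [map_sub, map_pow, AdjoinRoot.mk_X, AdjoinRoot.mk_C, map_add, map_pow] at h
  exact (sub_eq_zero.1 h).symm

theorem monic_equation : (equation K q).Monic :=
  monic_X_pow_sub_C _ (Nat.succ_ne_zero q)

theorem natDegree_equation : (equation K q).natDegree = q + 1 :=
  natDegree_X_pow_sub_C

theorem two_le (K : Type*) [Field K] [Finite K] (q : ℕ) [hK : Fact (Nat.card K = q ^ 2)] :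
    2 ≤ q := by
  have h1 := Finite.one_lt_card (α := K)
  rw [hK.out] at h1
  by_contra h
  have : q = 0 ∨ q = 1 := by omega
  rcases this with rfl | rfl <;> simp at h1

variable [Finite K] [hK : Fact (Nat.card K = q ^ 2)]

theorem cast_q_eq_zero : (q : K) = 0 := by
  have := Fintype.ofFinite K
  have h := Nat.cast_card_eq_zero K
  rw [← Nat.card_eq_fintype_card, hK.out, Nat.cast_pow] at h
  exact pow_eq_zero_iff (two_ne_zero) |>.1 h

theorem irreducible_equation : Irreducible (equation K q) := by
  have hq := two_le K q
  have hXP : (Ideal.span {(X : K[X])}).IsPrime :=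
    (Ideal.span_singleton_prime X_ne_zero).2 prime_X
  have hdeg := natDegree_equation K q
  have hcoeff0 : (equation K q).coeff 0 = -(X ^ q + X) := by
    rw [equation, coeff_sub, coeff_C_zero, coeff_X_pow, if_neg (by omega), zero_sub]
  refine IsEisensteinAt.irreducible (𝓟 := Ideal.span {(X : K[X])}) ⟨?_, ?_, ?_⟩ hXP
    (monic_equation K q).isPrimitive (by rw [hdeg]; omega)
  · rw [(monic_equation K q).leadingCoeff]
    exact (Ideal.ne_top_iff_one _).1 hXP.ne_top
  · intro n hn
    rw [hdeg] at hn
    rcases Nat.eq_zero_or_pos n with rfl | hn0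
    · rw [hcoeff0, neg_mem_iff]
      exact add_mem (Ideal.pow_mem_of_mem _ (Ideal.mem_span_singleton_self X) q (by omega))
        (Ideal.mem_span_singleton_self X)
    · have : (equation K q).coeff n = 0 := by
        rw [equation, coeff_sub, coeff_X_pow, coeff_C, if_neg hn.ne, if_neg (by omega), sub_zero]
      rw [this]
      exact zero_mem _
  · rw [hcoeff0, neg_mem_iff, Ideal.span_singleton_pow, Ideal.mem_span_singleton, X_pow_dvd_iff]
    intro h
    have h1 := h 1 (by norm_num)
    have hq1 : (1 : ℕ) ≠ q := by omega
    simp [coeff_X_pow, hq1] at h1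

instance : IsDomain (CoordinateRing K q) :=
  AdjoinRoot.isDomain_of_prime (irreducible_equation K q).prime

/-- The function field `K(x, y)` of the Hermitian curve. -/
abbrev FunctionField := FractionRing (CoordinateRing K q)

/-- The coordinate function `x` in the function field. -/
def x : FunctionField K q := algebraMap (CoordinateRing K q) _ (xR K q)

/-- The coordinate function `y` in the function field. -/
def y : FunctionField K q := algebraMap (CoordinateRing K q) _ (yR K q)

end

/-- The points of the Hermitian curve in the affine plane over `K`. The only further point of
the projective closure is `Y_∞ = (0 : 1 : 0)`. -/
@[ext]
structure AffinePoint (K : Type*) [Field K] (q : ℕ) where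
  /-- The `X`-coordinate. -/
  a : K
  /-- The `Y`-coordinate. -/
  b : K
  on_curve : b ^ q + b = a ^ (q + 1)

namespace AffinePoint

variable {K : Type*} [Field K] {q : ℕ}

instance [Finite K] : Finite (AffinePoint K q) :=
  Finite.of_injective (fun P : AffinePoint K q => (P.a, P.b)) fun P Q h => by
    rw [Prod.mk.injEq] at h
    exact AffinePoint.ext h.1 h.2

variable (P : AffinePoint K q)

/-- Evaluation of regular functions at a point. -/
def eval : CoordinateRing K q →+* K :=
  AdjoinRoot.lift (evalRingHom P.b) P.a (by
    rw [equation, eval₂_sub, eval₂_X_pow, eval₂_C, coe_evalRingHom, eval_add, eval_pow, eval_X,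
      P.on_curve, sub_self])

@[simp] theorem eval_xR : P.eval (xR K q) = P.a := by simp [eval, xR]

@[simp] theorem eval_yR : P.eval (yR K q) = P.b := by simp [eval, yR]

@[simp] theorem eval_algebraMap (c : K) :
    P.eval (algebraMap K (CoordinateRing K q) c) = c := by
  rw [AdjoinRoot.algebraMap_eq']
  simp [eval]

/-- The maximal ideal of the regular functions that vanish at a point. -/
def ideal : Ideal (CoordinateRing K q) := RingHom.ker P.eval

theorem mem_ideal {r : CoordinateRing K q} : r ∈ P.ideal ↔ P.eval r = 0 := RingHom.mem_ker

instance : P.ideal.IsPrime := RingHom.ker_isPrime _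

theorem ideal_le : P.ideal ≤
    Ideal.span {xR K q - algebraMap K _ P.a, yR K q - algebraMap K _ P.b} := by
  intro r hr
  rw [mem_ideal] at hr
  obtain ⟨p, rfl⟩ := AdjoinRoot.mk_surjective r
  obtain ⟨s, hs⟩ := X_sub_C_dvd_sub_C_eval (a := C P.a) (p := p)
  obtain ⟨t, ht⟩ := X_sub_C_dvd_sub_C_eval (a := P.b) (p := p.eval (C P.a))
  have hz : (p.eval (C P.a)).eval P.b = 0 := by
    have := hr
    rw [eval, AdjoinRoot.lift_mk] at this
    rw [← this, ← coe_evalRingHom, ← eval₂_hom, coe_evalRingHom, eval_C]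
  rw [hz, C_0, sub_zero] at ht
  rw [Ideal.mem_span_pair]
  refine ⟨AdjoinRoot.mk _ s, AdjoinRoot.of _ t, ?_⟩
  have hp : p = (X - C (C P.a)) * s + C ((X - C P.b) * t) := by rw [← ht, ← hs]; ring
  conv_rhs => rw [hp]
  simp only [xR, yR, AdjoinRoot.algebraMap_eq', map_add, map_mul, map_sub, AdjoinRoot.mk_X,
    AdjoinRoot.mk_C, RingHom.comp_apply, Polynomial.algebraMap_eq]
  ring

variable [Finite K] [hK : Fact (Nat.card K = q ^ 2)]

theorem xR_sub_ne_zero : xR K q - algebraMap K _ P.a ≠ 0 := by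
  have h : xR K q - algebraMap K _ P.a = AdjoinRoot.mk (equation K q) (X - C (C P.a)) := by
    simp [xR, AdjoinRoot.algebraMap_eq']
  rw [h]
  refine AdjoinRoot.mk_ne_zero_of_natDegree_lt (monic_equation K q) (X_sub_C_ne_zero _) ?_
  rw [natDegree_X_sub_C, natDegree_equation]
  have := two_le K q
  omega

/-- Smoothness of the curve at an affine point: up to a function not vanishing there,
`y - b` is a multiple of `x - a`. -/
theorem exists_smooth : ∃ u h : CoordinateRing K q, P.eval u ≠ 0 ∧
    u * (yR K q - algebraMap K _ P.b) = h * (xR K q - algebraMap K _ P.a) := by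
  refine ⟨∑ i ∈ Finset.range q, yR K q ^ i * algebraMap K _ P.b ^ (q - 1 - i) + 1,
    ∑ i ∈ Finset.range (q + 1), xR K q ^ i * algebraMap K _ P.a ^ (q + 1 - 1 - i), ?_, ?_⟩
  · have h : ∀ i ∈ Finset.range q, P.b ^ i * P.b ^ (q - 1 - i) = P.b ^ (q - 1) := by
      intro i hi
      rw [Finset.mem_range] at hi
      rw [← pow_add]
      congr 1
      omega
    simp only [map_add, map_sum, map_mul, map_pow, eval_yR, eval_algebraMap, map_one]
    rw [Finset.sum_congr rfl h]
    simp [cast_q_eq_zero K q]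
  · rw [add_mul, geom_sum₂_mul, geom_sum₂_mul, ← equation_xR_yR, ← map_pow, ← map_pow,
      ← P.on_curve, map_add]
    ring

theorem isDVR_localization : IsDiscreteValuationRing (Localization.AtPrime P.ideal) := by
  set S := Localization.AtPrime P.ideal
  have : IsNoetherianRing S := IsLocalization.isNoetherianRing P.ideal.primeCompl S inferInstance
  have hinj : Function.Injective (algebraMap (CoordinateRing K q) S) :=
    IsLocalization.injective S P.ideal.primeCompl_le_nonZeroDivisors
  set t : S := algebraMap _ S (xR K q - algebraMap K _ P.a)
  have ht0 : t ≠ 0 := fun h => P.xR_sub_ne_zero (hinj (by rw [map_zero]; exact h))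
  have htmem : t ∈ IsLocalRing.maximalIdeal S :=
    (IsLocalization.AtPrime.to_map_mem_maximal_iff S P.ideal _).2 (by simp [mem_ideal])
  have hmax : IsLocalRing.maximalIdeal S = Ideal.span {t} := by
    refine le_antisymm ?_ ((Ideal.span_singleton_le_iff_mem _).2 htmem)
    rw [← IsLocalization.AtPrime.map_eq_maximalIdeal P.ideal S]
    refine (Ideal.map_mono P.ideal_le).trans ?_
    rw [Ideal.map_span, Ideal.span_le]
    rintro _ ⟨r, hr, rfl⟩
    rcases hr with rfl | hr
    · exact Ideal.mem_span_singleton_self _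
    · rw [Set.mem_singleton_iff] at hr
      obtain ⟨u, h, hu, huh⟩ := P.exists_smooth
      have hunit : IsUnit (algebraMap _ S u) :=
        IsLocalization.map_units S (⟨u, fun hm => hu (P.mem_ideal.1 hm)⟩ : P.ideal.primeCompl)
      rw [SetLike.mem_coe, hr, ← Ideal.unit_mul_mem_iff_mem _ hunit, ← map_mul, huh, map_mul]
      exact Ideal.mul_mem_left _ _ (Ideal.mem_span_singleton_self _)
  have hnf : ¬ IsField S := by
    rw [IsLocalRing.isField_iff_maximalIdeal_eq]
    intro h
    rw [h] at htmem
    exact ht0 htmem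
  have hprin : (IsLocalRing.maximalIdeal S).IsPrincipal := ⟨⟨t, hmax⟩⟩
  exact ((IsDiscreteValuationRing.TFAE S hnf).out 0 4).2 hprin

/-- The local ring of the curve at an affine point: the functions `r / s` with `r`, `s`
regular and `s` not vanishing at the point. -/
def localRing : ValuationSubring (FunctionField K q) where
  carrier := {f | ∃ r s : CoordinateRing K q, P.eval s ≠ 0 ∧
    f = algebraMap _ (FunctionField K q) r / algebraMap _ (FunctionField K q) s}
  mul_mem' := by
    rintro _ _ ⟨r, s, hs, rfl⟩ ⟨r', s', hs', rfl⟩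
    exact ⟨r * r', s * s', by simp [hs, hs'], by simp [div_mul_div_comm]⟩
  one_mem' := ⟨1, 1, by simp, by simp⟩
  add_mem' := by
    rintro _ _ ⟨r, s, hs, rfl⟩ ⟨r', s', hs', rfl⟩
    have h : ∀ {s}, P.eval s ≠ 0 → algebraMap _ (FunctionField K q) s ≠ 0 := by
      intro s hs h0
      rw [FaithfulSMul.algebraMap_eq_zero_iff] at h0
      exact hs (by simp [h0])
    exact ⟨r * s' + s * r', s * s', by simp [hs, hs'], by simp [div_add_div _ _ (h hs) (h hs')]⟩
  zero_mem' := ⟨0, 1, by simp, by simp⟩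
  neg_mem' := by
    rintro _ ⟨r, s, hs, rfl⟩
    exact ⟨-r, s, hs, by simp [neg_div]⟩
  mem_or_inv_mem' := by
    have key : ∀ r s : CoordinateRing K q, s ≠ 0 →
        algebraMap _ (Localization.AtPrime P.ideal) s ∣ algebraMap _ _ r →
        ∃ c d : CoordinateRing K q, P.eval d ≠ 0 ∧
          algebraMap _ (FunctionField K q) r / algebraMap _ (FunctionField K q) s =
            algebraMap _ (FunctionField K q) c / algebraMap _ (FunctionField K q) d := by
      rintro r s hs ⟨z, hz⟩
      obtain ⟨⟨c, d⟩, hcd⟩ := IsLocalization.surj P.ideal.primeCompl z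
      have hd : P.eval d.1 ≠ 0 := fun h => d.2 (P.mem_ideal.2 h)
      refine ⟨c, d.1, hd, ?_⟩
      have hd0 : d.1 ≠ 0 := fun h => hd (by simp [h])
      have heq : r * d.1 = c * s := by
        apply IsLocalization.injective (Localization.AtPrime P.ideal)
          P.ideal.primeCompl_le_nonZeroDivisors
        rw [map_mul, map_mul, hz, mul_assoc, hcd, mul_comm]
      rw [div_eq_div_iff (by simpa using hs) (by simpa using hd0), ← map_mul, ← map_mul, heq]
    intro f
    obtain ⟨r, s, hs, rfl⟩ := IsFractionRing.div_surjective (A := CoordinateRing K q) f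
    have hs0 : s ≠ 0 := nonZeroDivisors.ne_zero hs
    have := P.isDVR_localization
    rcases ValuationRing.dvd_total (algebraMap _ (Localization.AtPrime P.ideal) s)
      (algebraMap _ _ r) with h | h
    · exact Or.inl (key r s hs0 h)
    · by_cases hr : r = 0
      · exact Or.inl ⟨0, 1, by simp, by simp [hr]⟩
      · rw [inv_div]
        exact Or.inr (key s r hr h)

theorem isDVR_localRing : IsDiscreteValuationRing P.localRing := by
  have hu : ∀ s : P.ideal.primeCompl,
      IsUnit (algebraMap (CoordinateRing K q) (FunctionField K q) s) := by
    intro s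
    refine isUnit_iff_ne_zero.2 fun h => s.2 ?_
    rw [FaithfulSMul.algebraMap_eq_zero_iff] at h
    rw [h]
    exact zero_mem _
  let φ : Localization.AtPrime P.ideal →+* FunctionField K q := IsLocalization.lift hu
  have hmk : ∀ r (s : P.ideal.primeCompl), φ (IsLocalization.mk' _ r s) =
      algebraMap _ (FunctionField K q) r / algebraMap _ (FunctionField K q) s.1 := by
    intro r s
    rw [IsLocalization.lift_mk'_spec, mul_div_cancel₀ _ (hu s).ne_zero]
  have hmem : ∀ z, φ z ∈ P.localRing := by
    intro z
    obtain ⟨r, s, rfl⟩ := IsLocalization.exists_mk'_eq P.ideal.primeCompl z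
    exact ⟨r, s.1, fun h => s.2 (P.mem_ideal.2 h), hmk r s⟩
  have hbij : Function.Bijective (φ.codRestrict P.localRing hmem) := by
    constructor
    · intro z w h
      have hinj : Function.Injective φ :=
        (IsLocalization.lift_injective_iff hu).2 fun a b => by
          rw [(IsLocalization.injective (Localization.AtPrime P.ideal)
            P.ideal.primeCompl_le_nonZeroDivisors).eq_iff,
            (IsFractionRing.injective (CoordinateRing K q) (FunctionField K q)).eq_iff]
      exact hinj (congrArg Subtype.val h)
    · rintro ⟨f, r, s, hs, rfl⟩
      exact ⟨IsLocalization.mk' _ r (⟨s, fun h => hs (P.mem_ideal.1 h)⟩ : P.ideal.primeCompl),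
        Subtype.ext (hmk r _)⟩
  have := P.isDVR_localization
  exact IsDiscreteValuationRing.RingEquivClass.isDiscreteValuationRing (RingEquiv.ofBijective _ hbij)

/-- The place of the function field at an affine point of the curve. -/
def place : Place K (FunctionField K q) where
  ring := P.localRing
  algebraMap_mem c := ⟨algebraMap K _ c, 1, by simp,
    by rw [map_one, div_one]; exact IsScalarTower.algebraMap_apply K (CoordinateRing K q) _ c⟩
  isDVR := P.isDVR_localRing

end AffinePoint

section

variable (K : Type*) [Field K] (q : ℕ)

variable [Finite K]

/-- The points of the Hermitian curve on the chord `O Y_∞`, which is the line `X = 0`,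
other than `O = (0, 0)` and `Y_∞`. -/
def chordPoints : Finset (AffinePoint K q) :=
  (Set.toFinite {P : AffinePoint K q | P.a = 0 ∧ ¬ (P.a = 0 ∧ P.b = 0)}).toFinset

/-- The divisor `m (Q_1 + ⋯ + Q_{q-1})`, where `Q_1, …, Q_{q-1}` are the points of the
curve on the chord `O Y_∞` other than `O` and `Y_∞`. -/
def chordDivisor [Fact (Nat.card K = q ^ 2)] (m : ℕ) : Divisor K (FunctionField K q) :=
  (m : ℤ) • ∑ Q ∈ chordPoints K q, Finsupp.single Q.place 1

end

end Hermitian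

end

/-
Since `y ^ q + y` has derivative `1`, the coordinate ring `R` is unramified over the polynomial ring
in `x`, hence Dedekind, so a function which is regular at every affine place lies in `R`, i.e. is a
polynomial in `x` and `y` of degree at most `q` in `x`. The function `x` has simple zeros at exactly
the affine places on the line `X = 0`, so `f x ^ m` is such a function for every `f` in the
Riemann–Roch space.
The monomials `x ^ i y ^ j` with `i ≤ q` have pairwise distinct vanishing orders `i + j (q + 1)` at
`O`, and pairwise distinct pole orders `i q + j (q + 1)` at infinity, as one sees by applying the
involution `(x, y) ↦ (x / y, 1 / y)`, which swaps the two points. So monomials cannot cancel, and as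
`f` is regular at both points, each monomial of `f x ^ m` satisfies `m ≤ i + j (q + 1)` and
`i q + j (q + 1) ≤ m q`, that is, either `(i, j) = (m, 0)`, or `1 ≤ j` and `i + j < m`.
-/

noncomputable section

open Polynomial

theorem withZero_exp_sum {ι M : Type*} [AddCommGroup M] (s : Finset ι) (f : ι → M) :
    WithZero.exp (∑ i ∈ s, f i) = ∏ i ∈ s, WithZero.exp (f i) := by
  induction s using Finset.cons_induction with
  | empty => simp
  | cons i s hi ih => rw [Finset.sum_cons, Finset.prod_cons, WithZero.exp_add, ih]

theorem valuation_le_map_sum_of_pairwise_ne {R Γ ι : Type*} [Ring R]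
    [LinearOrderedCommMonoidWithZero Γ] (v : Valuation R Γ) {s : Finset ι} {f : ι → R}
    (h : (s : Set ι).Pairwise fun i j => v (f i) ≠ v (f j)) {i : ι} (hi : i ∈ s) :
    v (f i) ≤ v (∑ j ∈ s, f j) := by
  classical
  obtain ⟨j, hj, hmax⟩ := s.exists_max_image (fun i => v (f i)) ⟨i, hi⟩
  have hlt : ∀ k ∈ s \ {j}, v (f k) < v (f j) := by
    intro k hk
    rw [Finset.mem_sdiff, Finset.mem_singleton] at hk
    exact (hmax k hk.1).lt_of_ne (h hk.1 hj hk.2)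
  by_cases h0 : v (f j) = 0
  · exact (hmax i hi).trans (h0 ▸ zero_le)
  · exact (hmax i hi).trans_eq (v.map_sum_eq_of_lt hj hlt).symm

namespace Place

variable {K F : Type*} [Field K] [Field F] [Algebra K F] (P : Place K F)

theorem mem_ring_iff {f : F} : f ∈ P.ring ↔ P.valuation f ≤ 1 := by
  constructor
  · intro h
    exact (IsDiscreteValuationRing.maximalIdeal P.ring).valuation_le_one (⟨f, h⟩ : P.ring)
  · intro h
    obtain ⟨a, rfl⟩ := IsDiscreteValuationRing.exists_lift_of_le_one (A := P.ring) h
    exact a.2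

theorem valuation_inv_lt_one_iff {f : F} (hf : f ≠ 0) : P.valuation f⁻¹ < 1 ↔ f ∉ P.ring := by
  rw [mem_ring_iff, not_le, map_inv₀, inv_lt_one₀ (P.valuation.pos_iff.2 hf)]

variable {P} in
theorem eq_of_ring_le {Q : Place K F} (hle : P.ring ≤ Q.ring)
    (hlt : ∀ f, P.valuation f < 1 → Q.valuation f < 1) : P = Q := by
  have hring : P.ring = Q.ring := le_antisymm hle fun f hfQ => by
    by_contra hfP
    have hf : f ≠ 0 := fun h => hfP (h ▸ zero_mem P.ring)
    exact (Q.valuation_inv_lt_one_iff hf).1 (hlt _ ((P.valuation_inv_lt_one_iff hf).2 hfP)) hfQ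
  cases P; cases Q; cases hring; rfl

theorem zero_le_ord_iff {f : F} (hf : f ≠ 0) : 0 ≤ P.ord f ↔ f ∈ P.ring := by
  simpa [mem_ring_iff] using P.zero_le_ord_add_iff hf 0

theorem valuation_algebraMap {c : K} (hc : c ≠ 0) : P.valuation (algebraMap K F c) = 1 := by
  have hle (d : K) : P.valuation (algebraMap K F d) ≤ 1 := P.mem_ring_iff.1 (P.algebraMap_mem d)
  refine le_antisymm (hle c) ?_
  have hinv := hle c⁻¹
  rwa [map_inv₀, map_inv₀, inv_le_one₀ (P.valuation.pos_iff.2 (by simpa using hc))] at hinv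

theorem valuation_eq_exp_neg_one {t : F} (ht : P.valuation t < 1)
    (hmax : ∀ f, P.valuation f < 1 → P.valuation f ≤ P.valuation t) :
    P.valuation t = WithZero.exp (-1 : ℤ) := by
  obtain ⟨π, hπ⟩ :=
    (IsDiscreteValuationRing.maximalIdeal P.ring).valuation_exists_uniformizer F
  have hπt : WithZero.exp (-1 : ℤ) ≤ P.valuation t := by
    rw [← hπ]
    exact hmax π (hπ.trans_lt (by rw [← WithZero.exp_zero, WithZero.exp_lt_exp]; norm_num))
  have h0 : P.valuation t ≠ 0 := (WithZero.exp_pos.trans_le hπt).ne'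
  obtain ⟨n, hn⟩ : ∃ n : ℤ, P.valuation t = WithZero.exp n := ⟨_, (WithZero.exp_log h0).symm⟩
  rw [hn, ← WithZero.exp_zero, WithZero.exp_lt_exp] at ht
  rw [hn, WithZero.exp_le_exp] at hπt
  rw [hn, show n = -1 by omega]

theorem degree_eq_one (h : ∀ f ∈ P.ring, ∃ c : K, P.valuation (f - algebraMap K F c) < 1) :
    P.degree = 1 := by
  refine (finrank_eq_one_iff_of_nonzero' (1 : IsLocalRing.ResidueField P.ring) one_ne_zero).2 ?_
  intro z
  obtain ⟨f, rfl⟩ := IsLocalRing.residue_surjective z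
  obtain ⟨c, hc⟩ := h f f.2
  have hmem : f - algebraMap K P.ring c ∈ IsLocalRing.maximalIdeal P.ring :=
    ((IsDiscreteValuationRing.maximalIdeal P.ring).valuation_lt_one_iff_mem (K := F) _).1 hc
  refine ⟨c, ?_⟩
  rw [← IsLocalRing.residue_eq_zero_iff, map_sub, sub_eq_zero] at hmem
  rw [hmem, Algebra.smul_def, mul_one]
  rfl

theorem zero_le_ord_add_iff_mul_pow_mem {t f : F} (ht : P.valuation t = WithZero.exp (-1 : ℤ))
    (hf : f ≠ 0) (n : ℕ) : 0 ≤ P.ord f + n ↔ f * t ^ n ∈ P.ring := by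
  rw [P.zero_le_ord_add_iff hf, mem_ring_iff, map_mul, map_pow, ht, ← WithZero.exp_nsmul,
    smul_neg, nsmul_one, WithZero.exp_neg, mul_inv_le_iff₀ WithZero.exp_pos, one_mul]

section aeval

variable {σ : Type*} {s : σ → F}

theorem valuation_aeval_monomial (d : σ →₀ ℕ) {c : K} (hc : c ≠ 0) :
    P.valuation (MvPolynomial.aeval s (MvPolynomial.monomial d c)) =
      d.prod fun i n => P.valuation (s i) ^ n := by
  rw [MvPolynomial.aeval_monomial, map_mul, P.valuation_algebraMap hc, one_mul, map_finsuppProd]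
  simp only [map_pow]

theorem valuation_aeval_le {γ : WithZero (Multiplicative ℤ)} (hs : ∀ i, P.valuation (s i) ≤ γ)
    (hγ : 1 ≤ γ) {p : MvPolynomial σ K} {n : ℕ} (hp : p.totalDegree ≤ n) :
    P.valuation (MvPolynomial.aeval s p) ≤ γ ^ n := by
  rw [p.as_sum, map_sum]
  refine P.valuation.map_sum_le fun d hd => ?_
  rw [P.valuation_aeval_monomial d (MvPolynomial.mem_support_iff.1 hd)]
  calc d.prod (fun i n => P.valuation (s i) ^ n)
      ≤ ∏ i ∈ d.support, γ ^ d i := Finset.prod_le_prod' fun i _ => pow_le_pow_left' (hs i) _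
    _ = γ ^ d.sum fun _ n => n := Finset.prod_pow_eq_pow_sum _ _ _
    _ ≤ γ ^ n := pow_le_pow_right₀ hγ ((MvPolynomial.le_totalDegree hd).trans hp)

theorem aeval_mem (hs : ∀ i, s i ∈ P.ring) (p : MvPolynomial σ K) :
    MvPolynomial.aeval s p ∈ P.ring := by
  have h := P.valuation_aeval_le (fun i => P.mem_ring_iff.1 (hs i)) le_rfl (p := p) le_rfl
  rwa [one_pow, ← mem_ring_iff] at h

theorem exp_weight_le_valuation_aeval {w : σ → ℤ}
    (hs : ∀ i, P.valuation (s i) = WithZero.exp (w i)) {p : MvPolynomial σ K}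
    (hp : Set.InjOn (Finsupp.weight w) (p.support : Set (σ →₀ ℕ))) {d : σ →₀ ℕ}
    (hd : d ∈ p.support) :
    WithZero.exp (Finsupp.weight w d) ≤ P.valuation (MvPolynomial.aeval s p) := by
  have hterm : ∀ e ∈ p.support,
      P.valuation (MvPolynomial.aeval s (MvPolynomial.monomial e (p.coeff e))) =
        WithZero.exp (Finsupp.weight w e) := by
    intro e he
    simp only [P.valuation_aeval_monomial e (MvPolynomial.mem_support_iff.1 he), hs,
      ← WithZero.exp_nsmul, Finsupp.weight_apply, Finsupp.sum, Finsupp.prod, withZero_exp_sum]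
  have hdistinct : (p.support : Set (σ →₀ ℕ)).Pairwise fun d e =>
      P.valuation (MvPolynomial.aeval s (MvPolynomial.monomial d (p.coeff d))) ≠
        P.valuation (MvPolynomial.aeval s (MvPolynomial.monomial e (p.coeff e))) := by
    intro d hd e he hde h
    rw [hterm d hd, hterm e he, WithZero.exp_inj] at h
    exact hde (hp hd he h)
  rw [← hterm d hd]
  conv_rhs => rw [p.as_sum, map_sum]
  exact valuation_le_map_sum_of_pairwise_ne P.valuation hdistinct hd

end aeval

theorem exists_mem_roots_valuation_sub_lt_one {p : K[X]} (hp : p.Monic) (hsplits : p.Splits)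
    {t : F} (ht : P.valuation (aeval t p) < 1) :
    ∃ b ∈ p.roots, P.valuation (t - algebraMap K F b) < 1 := by
  by_contra! h
  refine ht.not_ge ?_
  rw [hsplits.eq_prod_roots_of_monic hp, map_multiset_prod, map_multiset_prod, Multiset.map_map,
    Multiset.map_map]
  refine Multiset.one_le_prod_of_one_le fun γ hγ => ?_
  obtain ⟨b, hb, rfl⟩ := Multiset.mem_map.1 hγ
  simpa using h b hb

/-- The place of `F` obtained by transporting a place of `F'` along an isomorphism. -/
def comap {F' : Type*} [Field F'] [Algebra K F'] (P : Place K F') (e : F ≃ₐ[K] F') :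
    Place K F where
  ring := P.ring.comap (e : F →+* F')
  algebraMap_mem c := by simpa [ValuationSubring.mem_comap] using P.algebraMap_mem c
  isDVR := IsDiscreteValuationRing.RingEquivClass.isDiscreteValuationRing
    ((e : F ≃+* F').restrict (P.ring.comap (e : F →+* F')) P.ring fun _ => Iff.rfl).symm

theorem mem_comap_ring {F' : Type*} [Field F'] [Algebra K F'] (P : Place K F') (e : F ≃ₐ[K] F')
    {f : F} : f ∈ (P.comap e).ring ↔ e f ∈ P.ring := Iff.rfl

end Place

theorem Divisor.degree_smul_sum_single {K F ι : Type*} [Field K] [Field F] [Algebra K F]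
    (s : Finset ι) (P : ι → Place K F) (n : ℤ) :
    Divisor.degree (n • ∑ i ∈ s, Finsupp.single (P i) (1 : ℤ)) =
      n * ∑ i ∈ s, ((P i).degree : ℤ) := by
  classical
  rw [Divisor.degree, Finsupp.sum_smul_index (by simp), Finset.mul_sum,
    ← Finsupp.sum_finsetSum_index (by simp) (by intros; ring)]
  simp

theorem degreeOf_toMvPolynomial_of_ne {R σ : Type*} [CommSemiring R] {i j : σ} (h : j ≠ i)
    (p : R[X]) : (p.toMvPolynomial i).degreeOf j = 0 := by
  by_contra hdeg
  rw [Polynomial.toMvPolynomial_eq_rename_comp, ← ne_eq,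
    ← MvPolynomial.mem_vars_iff_degreeOf_ne_zero] at hdeg
  obtain ⟨-, -, hij⟩ := MvPolynomial.mem_vars_rename _ _ hdeg
  exact h hij.symm

section

variable {R : Type*} [CommRing R] {q : ℕ}

theorem monic_X_pow_add_X (hq : 2 ≤ q) : (X ^ q + X : R[X]).Monic := by
  refine monic_X_pow_add (degree_X_le.trans_lt ?_)
  exact_mod_cast hq

theorem natDegree_X_pow_add_X [Nontrivial R] (hq : 2 ≤ q) : (X ^ q + X : R[X]).natDegree = q := by
  rw [natDegree_add_eq_left_of_natDegree_lt] <;> rw [natDegree_X_pow]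
  rwa [natDegree_X]

end

section Unramified

variable {A B : Type*} [CommRing A] [CommRing B] [Algebra A B] {b : B} {f : A[X]}

theorem formallyUnramified_of_isUnit_aeval_derivative (hb : Algebra.adjoin A {b} = ⊤)
    (hf : aeval b f = 0) (hf' : IsUnit (aeval b (derivative f))) :
    Algebra.FormallyUnramified A B := by
  have hDb : KaehlerDifferential.D A B b = 0 := by
    have h := (KaehlerDifferential.D A B).map_aeval f b
    rwa [hf, map_zero, eq_comm, hf'.smul_eq_zero] at h
  have hD : KaehlerDifferential.D A B = 0 :=
    Derivation.ext_of_adjoin_eq_top {b} hb (by simpa using hDb)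
  rw [Algebra.formallyUnramified_iff, ← Submodule.subsingleton_iff B, ← subsingleton_iff_bot_eq_top,
    ← KaehlerDifferential.span_range_derivation A B, hD, eq_comm, Submodule.span_eq_bot]
  rintro _ ⟨c, rfl⟩
  rfl

theorem isDedekindDomain_of_isUnit_aeval_derivative [IsDedekindDomain A] [IsDomain B]
    (hb : Algebra.adjoin A {b} = ⊤) (hmonic : f.Monic) (hf : aeval b f = 0)
    (hf' : IsUnit (aeval b (derivative f))) : IsDedekindDomain B := by
  have hfin : Module.Finite A B := ⟨by
    rw [← Algebra.top_toSubmodule, ← hb]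
    exact IsIntegral.fg_adjoin_singleton ⟨f, hmonic, hf⟩⟩
  have hunram := formallyUnramified_of_isUnit_aeval_derivative hb hf hf'
  exact isDedekindDomain.of_formallyUnramified A B

end Unramified

theorem weight_fin_two (a b : ℤ) (d : Fin 2 →₀ ℕ) :
    Finsupp.weight ![a, b] d = d 0 * a + d 1 * b := by
  rw [Finsupp.weight_apply, Finsupp.sum_fintype _ _ (by simp), Fin.sum_univ_two]
  simp

theorem injOn_weight_of_isCoprime {a b : ℤ} (hb : b ≠ 0) (hab : IsCoprime a b) :
    Set.InjOn (Finsupp.weight ![a, b]) {d : Fin 2 →₀ ℕ | (d 0 : ℤ) < |b|} := by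
  intro d hd e he h
  rw [weight_fin_two, weight_fin_two] at h
  have hdvd : b ∣ (d 0 : ℤ) - e 0 :=
    hab.symm.dvd_of_dvd_mul_left ⟨(e 1 : ℤ) - d 1, by linear_combination h⟩
  have habs : |(d 0 : ℤ) - e 0| < |b| := by
    rw [Set.mem_ofPred_eq] at hd he
    rw [abs_lt]
    omega
  have h₀ : (d 0 : ℤ) = e 0 :=
    sub_eq_zero.1 (Int.eq_zero_of_abs_lt_dvd ((abs_dvd b _).2 hdvd) habs)
  rw [h₀, add_right_inj] at h
  have h₁ : (d 1 : ℤ) = e 1 := mul_right_cancel₀ hb h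
  ext i
  fin_cases i
  exacts [by exact_mod_cast h₀, by exact_mod_cast h₁]

theorem injOn_weight_support {R : Type*} [CommSemiring R] {p : MvPolynomial (Fin 2) R} {a b : ℤ}
    (hb : b ≠ 0) (hab : IsCoprime a b) (hp : (p.degreeOf 0 : ℤ) < |b|) :
    Set.InjOn (Finsupp.weight ![a, b]) (p.support : Set (Fin 2 →₀ ℕ)) :=
  (injOn_weight_of_isCoprime hb hab).mono fun d hd =>
    (Int.ofNat_le.2 (MvPolynomial.degreeOf_le_iff.1 le_rfl d hd)).trans_lt hp

theorem valuation_pow_add_self {R Γ : Type*} [Ring R] [LinearOrderedCommGroupWithZero Γ]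
    (v : Valuation R Γ) {n : ℕ} (hn : 2 ≤ n) {t : R} (ht : v t < 1) : v (t ^ n + t) = v t := by
  have hpow : v (t ^ (n - 1)) < v 1 := by
    rw [map_pow, map_one]
    exact pow_lt_one₀ zero_le ht (by omega)
  calc v (t ^ n + t) = v (t ^ (n - 1) + 1) * v t := by
        rw [← map_mul, add_mul, one_mul, ← pow_succ, Nat.sub_add_cancel (by omega)]
    _ = v t := by rw [v.map_add_eq_of_lt_right hpow, map_one, one_mul]

theorem finrank_restrictTotalDegree (R σ : Type*) [CommRing R] [Nontrivial R] [Fintype σ]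
    (n : ℕ) : Module.finrank R (MvPolynomial.restrictTotalDegree σ R n) =
      (n + Fintype.card σ).choose (Fintype.card σ) := by
  classical
  let T := (Finset.range (n + 1)).biUnion fun k => (Finset.univ : Finset σ).finsuppAntidiag k
  have hT : {d : σ →₀ ℕ | (d.sum fun _ e => e) ≤ n} = T := by
    ext d
    simp only [T, Set.mem_ofPred_eq, SetLike.mem_coe, Finset.mem_biUnion, Finset.mem_range_succ_iff,
      Finset.mem_finsuppAntidiag', Finset.subset_univ, and_true, exists_eq_right']
  have hdisj : (Finset.range (n + 1) : Set ℕ).PairwiseDisjoint fun k =>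
      (Finset.univ : Finset σ).finsuppAntidiag k := by
    intro k _ l _ hkl
    refine Finset.disjoint_left.2 fun d hd hd' => hkl ?_
    rw [Finset.mem_finsuppAntidiag] at hd hd'
    exact hd.1.symm.trans hd'.1
  rw [MvPolynomial.restrictTotalDegree, hT,
    Module.finrank_eq_nat_card_basis (MvPolynomial.basisRestrictSupport R _),
    Nat.card_coe_set_eq, Set.ncard_coe_finset, Finset.card_biUnion hdisj]
  simp only [Finset.card_finsuppAntidiag_nat_eq_multichoose, Nat.sum_range_multichoose,
    Finset.card_univ]

section

variable {R Γ : Type*} [Ring R] [LinearOrderedCommGroupWithZero Γ] (v : Valuation R Γ)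
  {n : ℕ} {s t : R}

theorem valuation_lt_one_of_pow_add_self_eq (hn : 2 ≤ n) (h : t ^ n + t = s ^ (n + 1))
    (ht : v t < 1) : v s < 1 := by
  rwa [← valuation_pow_add_self v hn ht, h, map_pow, pow_lt_one_iff n.succ_ne_zero] at ht

theorem valuation_le_pow_of_pow_add_self_eq (hn : 2 ≤ n) (h : t ^ n + t = s ^ (n + 1))
    (ht : v t < 1) {m : ℕ} (hm : m ≤ n + 1) : v t ≤ v s ^ m := by
  rw [← valuation_pow_add_self v hn ht, h, map_pow]
  exact pow_le_pow_right_of_le_one' (valuation_lt_one_of_pow_add_self_eq v hn h ht).le hm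

end

namespace Hermitian

/-! ### The coordinate ring -/

section

variable (K : Type*) [Field K] (q : ℕ)

theorem exists_natDegree_le_mk_eq (r : CoordinateRing K q) :
    ∃ g : K[X][X], g.natDegree ≤ q ∧ AdjoinRoot.mk (equation K q) g = r := by
  refine ⟨AdjoinRoot.modByMonicHom (monic_equation K q) r, ?_, AdjoinRoot.mk_leftInverse _ r⟩
  obtain ⟨g, rfl⟩ := AdjoinRoot.mk_surjective r
  rw [AdjoinRoot.modByMonicHom_mk, ← Nat.lt_succ_iff, Nat.succ_eq_add_one,
    ← natDegree_equation K q]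
  refine natDegree_modByMonic_lt g (monic_equation K q) fun h => ?_
  simpa [h] using natDegree_equation K q

theorem mk_C_eq_aeval_yR (c : K[X]) : AdjoinRoot.mk (equation K q) (C c) = aeval (yR K q) c := by
  refine DFunLike.congr_fun (f := (AdjoinRoot.ofAlgHom K (equation K q))) ?_ c
  ext
  simp [yR]

theorem exists_aeval_eq (r : CoordinateRing K q) : ∃ p : MvPolynomial (Fin 2) K,
    p.degreeOf 0 ≤ q ∧ MvPolynomial.aeval ![xR K q, yR K q] p = r := by
  obtain ⟨g, hg, rfl⟩ := exists_natDegree_le_mk_eq K q r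
  refine ⟨∑ i ∈ Finset.range (q + 1),
    (g.coeff i).toMvPolynomial (1 : Fin 2) * MvPolynomial.X 0 ^ i, ?_, ?_⟩
  · refine (MvPolynomial.degreeOf_sum_le _ _ _).trans (Finset.sup_le fun i hi => ?_)
    refine (MvPolynomial.degreeOf_mul_le _ _ _).trans ?_
    rw [degreeOf_toMvPolynomial_of_ne zero_ne_one, MvPolynomial.degreeOf_X_self_pow, zero_add]
    exact Finset.mem_range_succ_iff.1 hi
  · conv_rhs => rw [g.as_sum_range' _ (Nat.lt_succ_of_le hg)]
    simp only [map_sum, map_mul, map_pow, MvPolynomial.aeval_X, ← C_mul_X_pow_eq_monomial,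
      MvPolynomial.aeval_toMvPolynomial, mk_C_eq_aeval_yR, AdjoinRoot.mk_X, Matrix.cons_val_zero,
      Matrix.cons_val_one, xR]

theorem adjoin_xR_yR : Algebra.adjoin K {xR K q, yR K q} = ⊤ := by
  rw [← Matrix.range_cons_cons_empty _ _ ![], Algebra.adjoin_range_eq_range_aeval]
  exact (AlgHom.range_eq_top _).2 fun r => (exists_aeval_eq K q r).imp fun _ => And.right

theorem transcendental_y : Transcendental K (y K q) := by
  have h : degree (equation K q) ≠ 0 := by
    rw [degree_eq_natDegree (monic_equation K q).ne_zero, natDegree_equation]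
    exact_mod_cast Nat.succ_ne_zero q
  exact (transcendental_algebraMap_iff (IsFractionRing.injective _ _)).2
    ((transcendental_algebraMap_iff (AdjoinRoot.of.injective_of_degree_ne_zero h)).2
      (transcendental_X K))

variable [Finite K] [Fact (Nat.card K = q ^ 2)]

theorem derivative_X_pow_add_X {R : Type*} [CommRing R] [Algebra K R] :
    derivative (X ^ q + X : R[X]) = 1 := by
  have hq : (q : R) = 0 := by simpa using congrArg (algebraMap K R) (cast_q_eq_zero K q)
  rw [derivative_add, derivative_X_pow, derivative_X, hq, C_0, zero_mul, zero_add]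

instance : IsDedekindDomain (CoordinateRing K q) := by
  let A := Algebra.adjoin K {xR K q}
  have hA : IsPrincipalIdealRing (Algebra.adjoin K {xR K q}) := by
    rw [Algebra.adjoin_singleton_eq_range_aeval]
    exact IsPrincipalIdealRing.of_surjective _ (aeval (xR K q)).rangeRestrict_surjective
  let a : A := ⟨xR K q, Algebra.self_mem_adjoin_singleton K _⟩
  let f : A[X] := X ^ q + X - C (a ^ (q + 1))
  have hmonic : f.Monic := by
    refine (monic_X_pow_add_X (two_le K q)).sub_of_left (degree_C_le.trans_lt ?_)
    rw [← natDegree_pos_iff_degree_pos, natDegree_X_pow_add_X (two_le K q)]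
    exact zero_lt_two.trans_le (two_le K q)
  have hroot : aeval (yR K q) f = 0 := by
    simp only [f, map_add, map_sub, map_pow, aeval_X, aeval_C, equation_xR_yR]
    exact sub_self _
  have hderiv : derivative f = 1 := by
    rw [derivative_sub, derivative_X_pow_add_X K q, derivative_C, sub_zero]
  have htop : Algebra.adjoin A {yR K q} = ⊤ := by
    have h := adjoin_xR_yR K q
    rw [Set.insert_eq, Algebra.adjoin_union_eq_adjoin_adjoin,
      ← Subalgebra.restrictScalars_top (R := K) (S := A)] at h
    exact Subalgebra.restrictScalars_injective K h
  exact isDedekindDomain_of_isUnit_aeval_derivative htop hmonic hroot (by simp [hderiv])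

end

/-! ### Affine places -/

section

variable {K : Type*} [Field K] {q : ℕ}

theorem algebraMap_aeval (p : MvPolynomial (Fin 2) K) :
    algebraMap _ (FunctionField K q) (MvPolynomial.aeval ![xR K q, yR K q] p) =
      MvPolynomial.aeval ![x K q, y K q] p := by
  rw [← MvPolynomial.aeval_algebraMap_apply]
  congr 2
  exact List.ofFn_injective rfl

theorem algebraMap_xR_sub (c : K) : algebraMap _ (FunctionField K q)
    (xR K q - algebraMap K _ c) = x K q - algebraMap K _ c := by
  rw [map_sub, ← IsScalarTower.algebraMap_apply, x]

theorem algebraMap_yR_sub (c : K) : algebraMap _ (FunctionField K q)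
    (yR K q - algebraMap K _ c) = y K q - algebraMap K _ c := by
  rw [map_sub, ← IsScalarTower.algebraMap_apply, y]

variable [Finite K] [Fact (Nat.card K = q ^ 2)]

/-- The place of the function field at a nonzero prime of the coordinate ring. -/
def primePlace (v : IsDedekindDomain.HeightOneSpectrum (CoordinateRing K q)) :
    Place K (FunctionField K q) where
  ring := v.valuationSubringAtPrime (FunctionField K q)
  algebraMap_mem c := by
    rw [IsScalarTower.algebraMap_apply K (CoordinateRing K q)]
    exact (algebraMap (CoordinateRing K q)
      (v.valuationSubringAtPrime (FunctionField K q)) (algebraMap K _ c)).2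
  isDVR := IsLocalization.AtPrime.isDiscreteValuationRing_of_dedekind_domain
    (CoordinateRing K q) v.ne_bot _

theorem exists_algebraMap_eq_of_forall_place {f : FunctionField K q}
    (hf : ∀ P : Place K (FunctionField K q), x K q ∈ P.ring → y K q ∈ P.ring → f ∈ P.ring) :
    ∃ r, algebraMap (CoordinateRing K q) (FunctionField K q) r = f := by
  refine IsDedekindDomain.HeightOneSpectrum.mem_integers_of_valuation_le_one _ f fun v => ?_
  have hR (r : CoordinateRing K q) : algebraMap _ (FunctionField K q) r ∈ (primePlace v).ring :=
    (algebraMap (CoordinateRing K q) (v.valuationSubringAtPrime (FunctionField K q)) r).2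
  exact v.valuationSubringAtPrime_le_valuation (hf (primePlace v) (hR _) (hR _))

theorem algebraMap_mem_of_x_mem_of_y_mem {Q : Place K (FunctionField K q)}
    (hx : x K q ∈ Q.ring) (hy : y K q ∈ Q.ring) (r : CoordinateRing K q) :
    algebraMap _ (FunctionField K q) r ∈ Q.ring := by
  obtain ⟨p, -, rfl⟩ := exists_aeval_eq K q r
  rw [algebraMap_aeval]
  exact Q.aeval_mem (Fin.forall_fin_two.2 ⟨hx, hy⟩) p

end

namespace AffinePoint

variable {K : Type*} [Field K] {q : ℕ} (P : AffinePoint K q)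

theorem algebraMap_ne_zero_of_eval {s : CoordinateRing K q} (hs : P.eval s ≠ 0) :
    algebraMap _ (FunctionField K q) s ≠ 0 := by
  rw [ne_eq, FaithfulSMul.algebraMap_eq_zero_iff]
  rintro rfl
  exact hs (map_zero _)

variable [Finite K] [Fact (Nat.card K = q ^ 2)]

theorem algebraMap_mem_place_ring (r : CoordinateRing K q) :
    algebraMap _ (FunctionField K q) r ∈ P.place.ring :=
  ⟨r, 1, by simp, by simp⟩

theorem valuation_algebraMap_lt_one_iff {r : CoordinateRing K q} :
    P.place.valuation (algebraMap _ (FunctionField K q) r) < 1 ↔ P.eval r = 0 := by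
  by_cases hr : algebraMap _ (FunctionField K q) r = 0
  · simp [(FaithfulSMul.algebraMap_eq_zero_iff _ _).1 hr]
  rw [← inv_inv (algebraMap _ _ r), P.place.valuation_inv_lt_one_iff (inv_ne_zero hr), not_iff_comm]
  constructor
  · exact fun h => ⟨1, r, h, by simp⟩
  · rintro ⟨c, s, hs, h⟩ hr0
    rw [inv_eq_iff_eq_inv, inv_div, eq_div_iff_mul_eq, ← map_mul] at h
    · have h' := IsFractionRing.injective _ _ h
      exact hs (by rw [← h', map_mul, hr0, zero_mul])
    · rintro hc
      rw [hc, div_zero] at h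
      exact hr h

theorem valuation_algebraMap_eq_one {s : CoordinateRing K q} (hs : P.eval s ≠ 0) :
    P.place.valuation (algebraMap _ (FunctionField K q) s) = 1 :=
  le_antisymm (P.place.mem_ring_iff.1 (P.algebraMap_mem_place_ring s))
    (not_lt.1 (P.valuation_algebraMap_lt_one_iff.not.2 hs))

theorem valuation_y_sub_le :
    P.place.valuation (y K q - algebraMap K _ P.b) ≤
      P.place.valuation (x K q - algebraMap K _ P.a) := by
  obtain ⟨u, h, hu, huh⟩ := P.exists_smooth
  have hval := congrArg (fun r => P.place.valuation (algebraMap _ (FunctionField K q) r)) huh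
  simp only [map_mul, algebraMap_xR_sub, algebraMap_yR_sub, P.valuation_algebraMap_eq_one hu,
    one_mul] at hval
  rw [hval]
  exact mul_le_of_le_one_left' (P.place.mem_ring_iff.1 (P.algebraMap_mem_place_ring h))

theorem valuation_algebraMap_le_max {Q : Place K (FunctionField K q)} (hx : x K q ∈ Q.ring)
    (hy : y K q ∈ Q.ring) {r : CoordinateRing K q} (hr : P.eval r = 0) :
    Q.valuation (algebraMap _ (FunctionField K q) r) ≤
      max (Q.valuation (x K q - algebraMap K _ P.a))
        (Q.valuation (y K q - algebraMap K _ P.b)) := by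
  have hR (s : CoordinateRing K q) : Q.valuation (algebraMap _ (FunctionField K q) s) ≤ 1 :=
    Q.mem_ring_iff.1 (algebraMap_mem_of_x_mem_of_y_mem hx hy s)
  obtain ⟨c, d, rfl⟩ := Ideal.mem_span_pair.1 (P.ideal_le (P.mem_ideal.2 hr))
  rw [map_add, map_mul, map_mul, algebraMap_xR_sub, algebraMap_yR_sub]
  refine (Q.valuation.map_add _ _).trans (max_le_max ?_ ?_) <;> rw [map_mul]
  · exact mul_le_of_le_one_left' (hR c)
  · exact mul_le_of_le_one_left' (hR d)

theorem valuation_x_sub : P.place.valuation (x K q - algebraMap K _ P.a) =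
    WithZero.exp (-1 : ℤ) := by
  refine P.place.valuation_eq_exp_neg_one ?_ fun f hf => ?_
  · rw [← algebraMap_xR_sub, valuation_algebraMap_lt_one_iff]
    simp
  · obtain ⟨r, s, hs, rfl⟩ := P.place.mem_ring_iff.2 hf.le
    rw [map_div₀, P.valuation_algebraMap_eq_one hs, div_one] at hf ⊢
    exact (P.valuation_algebraMap_le_max (P.algebraMap_mem_place_ring _)
      (P.algebraMap_mem_place_ring _) (P.valuation_algebraMap_lt_one_iff.1 hf)).trans_eq
        (max_eq_left P.valuation_y_sub_le)

theorem degree_place : P.place.degree = 1 := by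
  refine P.place.degree_eq_one ?_
  rintro _ ⟨r, s, hs, rfl⟩
  refine ⟨P.eval r / P.eval s, ?_⟩
  rw [div_sub' (P.algebraMap_ne_zero_of_eval hs), map_div₀, P.valuation_algebraMap_eq_one hs,
    div_one, IsScalarTower.algebraMap_apply K (CoordinateRing K q), ← map_mul, ← map_sub,
    valuation_algebraMap_lt_one_iff, map_sub, map_mul, eval_algebraMap, mul_div_cancel₀ _ hs,
    sub_self]

theorem place_injective : Function.Injective fun P : AffinePoint K q => P.place := by
  intro P Q (h : P.place = Q.place)
  have heval (r : CoordinateRing K q) (hr : P.eval r = 0) : Q.eval r = 0 := by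
    rwa [← valuation_algebraMap_lt_one_iff, ← h, valuation_algebraMap_lt_one_iff]
  have ha := heval (xR K q - algebraMap K _ P.a) (by simp)
  have hb := heval (yR K q - algebraMap K _ P.b) (by simp)
  rw [map_sub, eval_algebraMap, sub_eq_zero] at ha hb
  exact AffinePoint.ext (by simpa using ha.symm) (by simpa using hb.symm)

theorem eq_place {Q : Place K (FunctionField K q)}
    (hx : Q.valuation (x K q - algebraMap K _ P.a) < 1)
    (hy : Q.valuation (y K q - algebraMap K _ P.b) < 1) : Q = P.place := by
  have hxQ : x K q ∈ Q.ring := by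
    simpa using add_mem (Q.mem_ring_iff.2 hx.le) (Q.algebraMap_mem P.a)
  have hyQ : y K q ∈ Q.ring := by
    simpa using add_mem (Q.mem_ring_iff.2 hy.le) (Q.algebraMap_mem P.b)
  have hlt {r : CoordinateRing K q} (hr : P.eval r = 0) :
      Q.valuation (algebraMap _ (FunctionField K q) r) < 1 :=
    (P.valuation_algebraMap_le_max hxQ hyQ hr).trans_lt (max_lt hx hy)
  have hone {s : CoordinateRing K q} (hs : P.eval s ≠ 0) :
      Q.valuation (algebraMap _ (FunctionField K q) s) = 1 := by
    have hsub := hlt (r := s - algebraMap K _ (P.eval s)) (by simp)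
    rw [map_sub, ← IsScalarTower.algebraMap_apply, ← Q.valuation_algebraMap hs] at hsub
    rw [← Q.valuation_algebraMap hs]
    simpa using Q.valuation.map_add_eq_of_lt_left hsub
  refine (Place.eq_of_ring_le ?_ fun f hf => ?_).symm
  · rintro _ ⟨r, s, hs, rfl⟩
    rw [Q.mem_ring_iff, map_div₀, hone hs, div_one, ← Q.mem_ring_iff]
    exact algebraMap_mem_of_x_mem_of_y_mem hxQ hyQ r
  · obtain ⟨r, s, hs, rfl⟩ := P.place.mem_ring_iff.2 hf.le
    rw [map_div₀, P.valuation_algebraMap_eq_one hs, div_one, valuation_algebraMap_lt_one_iff] at hf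
    rw [map_div₀, hone hs, div_one]
    exact hlt hf

end AffinePoint

/-! ### The chord divisor -/

section

variable (K : Type*) [Field K] (q : ℕ)

theorem equation_x_y : y K q ^ q + y K q = x K q ^ (q + 1) := by
  rw [y, x, ← map_pow, ← map_pow, ← map_add, equation_xR_yR]

theorem y_ne_zero : y K q ≠ 0 := fun h =>
  transcendental_y K q (h ▸ isAlgebraic_zero)

variable [Finite K]

theorem mem_chordPoints {P : AffinePoint K q} : P ∈ chordPoints K q ↔ P.a = 0 ∧ P.b ≠ 0 := by
  rw [chordPoints, Set.Finite.mem_toFinset, Set.mem_ofPred_eq]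
  tauto

variable [Fact (Nat.card K = q ^ 2)]

theorem x_ne_zero : x K q ≠ 0 := by
  intro hx
  refine transcendental_y K q ⟨X ^ q + X, (monic_X_pow_add_X (two_le K q)).ne_zero, ?_⟩
  rw [map_add, map_pow, aeval_X, equation_x_y, hx, zero_pow q.succ_ne_zero]

theorem add_pow_q {A : Type*} [CommRing A] [Algebra K A] (a b : A) :
    (a + b) ^ q = a ^ q + b ^ q := by
  have := Fintype.ofFinite K
  obtain ⟨p, hp⟩ := CharP.exists K
  obtain ⟨n, hprime, hn⟩ := FiniteField.card K p
  rw [← Nat.card_eq_fintype_card, Fact.out (p := Nat.card K = q ^ 2)] at hn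
  obtain ⟨k, -, rfl⟩ := (Nat.dvd_prime_pow hprime).1 (hn ▸ dvd_pow_self q two_ne_zero)
  rcases subsingleton_or_nontrivial A with h | h
  · exact Subsingleton.elim _ _
  have : CharP A p := charP_of_injective_algebraMap (algebraMap K A).injective p
  have := Fact.mk hprime
  exact add_pow_char_pow a b p k

theorem X_pow_add_X_dvd : (X ^ q + X : K[X]) ∣ X ^ Nat.card K - X := by
  have h : (X ^ Nat.card K - X : K[X]) = (X ^ q + X) ^ q - (X ^ q + X) := by
    rw [add_pow_q K q, Fact.out (p := Nat.card K = q ^ 2), ← pow_mul]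
    ring
  rw [h]
  exact dvd_sub (dvd_pow_self _ (zero_lt_two.trans_le (two_le K q)).ne') dvd_rfl

theorem splits_X_pow_add_X : (X ^ q + X : K[X]).Splits :=
  splits_X_pow_nat_card_sub_X.of_dvd
    (FiniteField.X_pow_card_sub_X_ne_zero K Finite.one_lt_card) (X_pow_add_X_dvd K q)

theorem separable_X_pow_add_X : (X ^ q + X : K[X]).Separable := by
  rw [Polynomial.Separable, derivative_X_pow_add_X K q]
  exact isCoprime_one_right

variable {K q} in
theorem mem_roots_X_pow_add_X {b : K} : b ∈ (X ^ q + X : K[X]).roots ↔ b ^ q + b = 0 := by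
  rw [mem_roots (monic_X_pow_add_X (two_le K q)).ne_zero]
  simp

theorem card_chordPoints : (chordPoints K q).card = q - 1 := by
  classical
  have hcard : (X ^ q + X : K[X]).roots.toFinset.card = q := by
    rw [Multiset.toFinset_card_of_nodup (nodup_roots (separable_X_pow_add_X K q)),
      ← (splits_X_pow_add_X K q).natDegree_eq_card_roots, natDegree_X_pow_add_X (two_le K q)]
  have hzero : (0 : K) ∈ (X ^ q + X : K[X]).roots.toFinset := by
    rw [Multiset.mem_toFinset, mem_roots_X_pow_add_X, add_zero]
    exact zero_pow (zero_lt_two.trans_le (two_le K q)).ne'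
  rw [← congrArg (· - 1) hcard, ← Finset.card_erase_of_mem hzero]
  refine Finset.card_bij (fun P _ => P.b) (fun P hP => ?_) (fun P hP Q hQ h => ?_) fun b hb => ?_
  · rw [mem_chordPoints] at hP
    rw [Finset.mem_erase, Multiset.mem_toFinset, mem_roots_X_pow_add_X, P.on_curve, hP.1]
    exact ⟨hP.2, zero_pow q.succ_ne_zero⟩
  · rw [mem_chordPoints] at hP hQ
    exact AffinePoint.ext (hP.1.trans hQ.1.symm) h
  · rw [Finset.mem_erase, Multiset.mem_toFinset, mem_roots_X_pow_add_X] at hb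
    exact ⟨⟨0, b, hb.2.trans (zero_pow q.succ_ne_zero).symm⟩,
      (mem_chordPoints K q).2 ⟨rfl, hb.1⟩, rfl⟩

theorem degree_chordDivisor (m : ℕ) : (chordDivisor K q m).degree = m * ((q : ℤ) - 1) := by
  simp only [chordDivisor, Divisor.degree_smul_sum_single, AffinePoint.degree_place,
    Finset.sum_const, card_chordPoints, nsmul_eq_mul, Nat.cast_one, mul_one,
    Nat.cast_pred (zero_lt_two.trans_le (two_le K q))]

variable {K q}

theorem chordDivisor_place {Q : AffinePoint K q} (hQ : Q ∈ chordPoints K q) (m : ℕ) :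
    chordDivisor K q m Q.place = m := by
  classical
  rw [chordDivisor, Finsupp.smul_apply, Finsupp.finsetSum_apply, Finset.sum_eq_single Q]
  · simp
  · exact fun P _ hPQ => Finsupp.single_eq_of_ne (AffinePoint.place_injective.ne hPQ.symm)
  · exact fun h => absurd hQ h

theorem chordDivisor_eq_zero {P : Place K (FunctionField K q)}
    (h : ∀ Q ∈ chordPoints K q, P ≠ Q.place) (m : ℕ) : chordDivisor K q m P = 0 := by
  rw [chordDivisor, Finsupp.smul_apply, Finsupp.finsetSum_apply, Finset.sum_eq_zero, smul_zero]
  exact fun Q hQ => Finsupp.single_eq_of_ne (h Q hQ)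

theorem AffinePoint.valuation_x_of_a_eq_zero {P : AffinePoint K q} (hP : P.a = 0) :
    P.place.valuation (x K q) = WithZero.exp (-1 : ℤ) := by
  rw [← P.valuation_x_sub, hP, map_zero, sub_zero]

theorem mem_riemannRochSpace_chordDivisor {f : FunctionField K q} {m : ℕ} :
    f ∈ riemannRochSpace (chordDivisor K q m) ↔
      (∀ Q ∈ chordPoints K q, f * x K q ^ m ∈ Q.place.ring) ∧
      ∀ P : Place K (FunctionField K q), (∀ Q ∈ chordPoints K q, P ≠ Q.place) → f ∈ P.ring := by
  change f = 0 ∨ (∀ P : Place K (FunctionField K q), 0 ≤ P.ord f + chordDivisor K q m P) ↔ _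
  by_cases hf : f = 0
  · simp [hf, zero_mem]
  have hchord (Q) (hQ : Q ∈ chordPoints K q) :
      0 ≤ Q.place.ord f + chordDivisor K q m Q.place ↔ f * x K q ^ m ∈ Q.place.ring := by
    rw [chordDivisor_place hQ]
    exact Q.place.zero_le_ord_add_iff_mul_pow_mem
      (AffinePoint.valuation_x_of_a_eq_zero ((mem_chordPoints K q).1 hQ).1) hf m
  have hother (P : Place K (FunctionField K q)) (hP : ∀ Q ∈ chordPoints K q, P ≠ Q.place) :
      0 ≤ P.ord f + chordDivisor K q m P ↔ f ∈ P.ring := by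
    rw [chordDivisor_eq_zero hP, add_zero, P.zero_le_ord_iff hf]
  rw [or_iff_right hf]
  constructor
  · exact fun h => ⟨fun Q hQ => (hchord Q hQ).1 (h _), fun P hP => (hother P hP).1 (h P)⟩
  · rintro ⟨h₁, h₂⟩ P
    by_cases hP : ∀ Q ∈ chordPoints K q, P ≠ Q.place
    · exact (hother P hP).2 (h₂ P hP)
    · push Not at hP
      obtain ⟨Q, hQ, rfl⟩ := hP
      exact (hchord Q hQ).2 (h₁ Q hQ)

theorem exists_eq_place_of_valuation_x_lt_one {P : Place K (FunctionField K q)}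
    (hx : P.valuation (x K q) < 1) : ∃ Q : AffinePoint K q, Q.a = 0 ∧ P = Q.place := by
  have ht : P.valuation (aeval (y K q) (X ^ q + X : K[X])) < 1 := by
    rw [map_add, map_pow, aeval_X, equation_x_y, map_pow]
    exact pow_lt_one₀ zero_le hx q.succ_ne_zero
  obtain ⟨b, hb, hyb⟩ := P.exists_mem_roots_valuation_sub_lt_one
    (monic_X_pow_add_X (two_le K q)) (splits_X_pow_add_X K q) ht
  rw [mem_roots_X_pow_add_X] at hb
  let Q : AffinePoint K q := ⟨0, b, hb.trans (zero_pow q.succ_ne_zero).symm⟩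
  exact ⟨Q, rfl, Q.eq_place (by simpa [Q] using hx) hyb⟩

end

/-! ### Orders of vanishing at `O` and at infinity -/

section

variable {K : Type*} [Field K] {q : ℕ}

theorem algHom_ext {A : Type*} [Semiring A] [Algebra K A] {f g : FunctionField K q →ₐ[K] A}
    (hx : f (x K q) = g (x K q)) (hy : f (y K q) = g (y K q)) : f = g := by
  refine IsLocalization.algHom_ext (nonZeroDivisors (CoordinateRing K q)) ?_
  refine AlgHom.ext_of_adjoin_eq_top (adjoin_xR_yR K q) ?_
  rintro _ (rfl | rfl)
  exacts [hx, hy]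

end

section

variable (K : Type*) [Field K] (q : ℕ) [Finite K] [Fact (Nat.card K = q ^ 2)]

theorem equation_at_infinity : (y K q)⁻¹ ^ q + (y K q)⁻¹ = (x K q / y K q) ^ (q + 1) := by
  have hy := y_ne_zero K q
  rw [div_pow, ← equation_x_y, pow_succ, inv_pow]
  field_simp
  ring

/-- The pullback of regular functions along the involution `(x, y) ↦ (x / y, 1 / y)`. -/
def involutionRegular : CoordinateRing K q →ₐ[K] FunctionField K q :=
  AdjoinRoot.liftAlgHom (equation K q) (aeval (y K q)⁻¹) (x K q / y K q) (by
    change eval₂ _ _ (X ^ (q + 1) - C (X ^ q + X)) = 0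
    rw [eval₂_sub, eval₂_X_pow, eval₂_C, ← equation_at_infinity]
    simp)

theorem involutionRegular_xR : involutionRegular K q (xR K q) = x K q / y K q :=
  AdjoinRoot.liftAlgHom_root _ _ _ _

theorem involutionRegular_yR : involutionRegular K q (yR K q) = (y K q)⁻¹ :=
  (AdjoinRoot.liftAlgHom_of _ _ _ _ _).trans (aeval_X _)

theorem transcendental_inv_y : Transcendental K (y K q)⁻¹ := fun h =>
  transcendental_y K q (by simpa using h.inv)

theorem involutionRegular_injective : Function.Injective (involutionRegular K q) := by
  have hfinite : Module.Finite K[X] (CoordinateRing K q) := (monic_equation K q).finite_adjoinRoot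
  have : (RingHom.ker (involutionRegular K q)).IsPrime := RingHom.ker_isPrime _
  refine (RingHom.injective_iff_ker_eq_bot _).2 (Ideal.eq_bot_of_comap_eq_bot (R := K[X]) ?_)
  rw [eq_bot_iff]
  intro p (hp : involutionRegular K q (AdjoinRoot.of (equation K q) p) = 0)
  rw [involutionRegular, AdjoinRoot.liftAlgHom_of] at hp
  exact transcendental_iff.1 (transcendental_inv_y K q) p hp

/-- The pullback of rational functions along the involution `(x, y) ↦ (x / y, 1 / y)`. -/
def involutionHom : FunctionField K q →ₐ[K] FunctionField K q :=
  IsFractionRing.liftAlgHom (involutionRegular_injective K q)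

theorem involutionHom_x : involutionHom K q (x K q) = x K q / y K q := by
  rw [involutionHom, IsFractionRing.coe_liftAlgHom, x, IsFractionRing.lift_algebraMap]
  exact involutionRegular_xR K q

theorem involutionHom_y : involutionHom K q (y K q) = (y K q)⁻¹ := by
  rw [involutionHom, IsFractionRing.coe_liftAlgHom, y, IsFractionRing.lift_algebraMap]
  exact involutionRegular_yR K q

theorem involutionHom_comp_self :
    (involutionHom K q).comp (involutionHom K q) = AlgHom.id K (FunctionField K q) := by
  refine algHom_ext ?_ ?_
  · simp [involutionHom_x, involutionHom_y, y_ne_zero K q]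
  · simp [involutionHom_y]

/-- The involution `(x, y) ↦ (x / y, 1 / y)` of the function field, which exchanges `O` and the
point at infinity. -/
def involution : FunctionField K q ≃ₐ[K] FunctionField K q :=
  AlgEquiv.ofAlgHom (involutionHom K q) (involutionHom K q) (involutionHom_comp_self K q)
    (involutionHom_comp_self K q)

theorem involution_x : involution K q (x K q) = x K q / y K q := involutionHom_x K q

theorem involution_y : involution K q (y K q) = (y K q)⁻¹ := involutionHom_y K q

theorem involution_aeval (p : MvPolynomial (Fin 2) K) :
    involution K q (MvPolynomial.aeval ![x K q, y K q] p) =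
      MvPolynomial.aeval ![x K q / y K q, (y K q)⁻¹] p := by
  rw [← AlgEquiv.coe_toAlgHom, MvPolynomial.comp_aeval_apply]
  congr 2
  ext i
  fin_cases i
  exacts [involution_x K q, involution_y K q]

/-- The point `O = (0, 0)` of the curve. -/
def origin : AffinePoint K q :=
  ⟨0, 0, by rw [add_zero, zero_pow (zero_lt_two.trans_le (two_le K q)).ne',
    zero_pow q.succ_ne_zero]⟩

/-- The place at the point at infinity, encoded as the image of the place at `O` under the
involution. -/
def infinityPlace : Place K (FunctionField K q) := (origin K q).place.comap (involution K q)

theorem valuation_origin_x : (origin K q).place.valuation (x K q) = WithZero.exp (-1 : ℤ) :=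
  AffinePoint.valuation_x_of_a_eq_zero rfl

theorem valuation_origin_y :
    (origin K q).place.valuation (y K q) = WithZero.exp (-(q + 1) : ℤ) := by
  have hy : (origin K q).place.valuation (y K q) < 1 := by
    rw [y, AffinePoint.valuation_algebraMap_lt_one_iff, AffinePoint.eval_yR]
    rfl
  rw [← valuation_pow_add_self _ (two_le K q) hy, equation_x_y, map_pow, valuation_origin_x,
    ← WithZero.exp_nsmul]
  congr 1
  simp

theorem valuation_origin_x_div_y :
    (origin K q).place.valuation (x K q / y K q) = WithZero.exp (q : ℤ) := by
  rw [map_div₀, valuation_origin_x, valuation_origin_y, ← WithZero.exp_sub]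
  congr 1
  ring

theorem valuation_origin_inv_y :
    (origin K q).place.valuation (y K q)⁻¹ = WithZero.exp (q + 1 : ℤ) := by
  rw [map_inv₀, valuation_origin_y, ← WithZero.exp_neg, neg_neg]

theorem y_notMem_infinityPlace_ring : y K q ∉ (infinityPlace K q).ring := by
  rw [infinityPlace, Place.mem_comap_ring, involution_y, Place.mem_ring_iff,
    valuation_origin_inv_y, ← WithZero.exp_zero, WithZero.exp_le_exp]
  omega

variable {K q} {p : MvPolynomial (Fin 2) K} (hp : p.degreeOf 0 ≤ q)
include hp

theorem exp_le_valuation_origin_aeval {d : Fin 2 →₀ ℕ} (hd : d ∈ p.support) :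
    WithZero.exp (d 0 * -1 + d 1 * -(q + 1) : ℤ) ≤
      (origin K q).place.valuation (MvPolynomial.aeval ![x K q, y K q] p) := by
  rw [← weight_fin_two]
  exact Place.exp_weight_le_valuation_aeval _
    (Fin.forall_fin_two.2 ⟨valuation_origin_x K q, valuation_origin_y K q⟩)
    (injOn_weight_support (by grind) isCoprime_one_left.neg_left (by grind)) hd

theorem exp_le_valuation_origin_involution_aeval {d : Fin 2 →₀ ℕ} (hd : d ∈ p.support) :
    WithZero.exp (d 0 * q + d 1 * (q + 1) : ℤ) ≤
      (origin K q).place.valuation (involution K q (MvPolynomial.aeval ![x K q, y K q] p)) := by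
  rw [← weight_fin_two, involution_aeval]
  exact Place.exp_weight_le_valuation_aeval _
    (Fin.forall_fin_two.2 ⟨valuation_origin_x_div_y K q, valuation_origin_inv_y K q⟩)
    (injOn_weight_support (by grind) ⟨-1, 1, by ring⟩ (by grind)) hd

theorem eq_zero_of_aeval_eq_zero (h : MvPolynomial.aeval ![x K q, y K q] p = 0) : p = 0 := by
  by_contra h0
  obtain ⟨d, hd⟩ := MvPolynomial.support_nonempty.2 h0
  have hle := exp_le_valuation_origin_aeval hp hd
  rw [h, Valuation.map_zero, le_zero_iff] at hle
  exact WithZero.exp_ne_zero hle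

variable {f : FunctionField K q} {m : ℕ} (hf : f * x K q ^ m = MvPolynomial.aeval ![x K q, y K q] p)
include hf

theorem le_of_mem_origin_ring (hO : f ∈ (origin K q).place.ring) {d : Fin 2 →₀ ℕ}
    (hd : d ∈ p.support) : m ≤ d 0 + d 1 * (q + 1) := by
  have hle := exp_le_valuation_origin_aeval hp hd
  rw [← hf, map_mul, map_pow, valuation_origin_x, ← WithZero.exp_nsmul] at hle
  have := WithZero.exp_le_exp.1
    (hle.trans (mul_le_of_le_one_left' ((Place.mem_ring_iff _).1 hO)))
  rw [nsmul_eq_mul] at this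
  zify
  linarith

theorem le_of_mem_infinityPlace_ring (hinf : f ∈ (infinityPlace K q).ring) {d : Fin 2 →₀ ℕ}
    (hd : d ∈ p.support) : d 0 * q + d 1 * (q + 1) ≤ m * q := by
  have hle := exp_le_valuation_origin_involution_aeval hp hd
  rw [← hf, map_mul, map_mul, map_pow, map_pow, involution_x, valuation_origin_x_div_y,
    ← WithZero.exp_nsmul] at hle
  have := WithZero.exp_le_exp.1
    (hle.trans (mul_le_of_le_one_left' ((Place.mem_ring_iff _).1 hinf)))
  rw [nsmul_eq_mul] at this
  exact_mod_cast this

end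

/-! ### The Riemann–Roch space -/

section

variable {K : Type*} [Field K] {q : ℕ} [Finite K] [Fact (Nat.card K = q ^ 2)]
  {P : Place K (FunctionField K q)} {m : ℕ} {g : MvPolynomial (Fin 2) K}

theorem x_mem_of_y_mem (hy : y K q ∈ P.ring) : x K q ∈ P.ring := by
  have h : x K q ^ (q + 1) ∈ P.ring := by
    rw [← equation_x_y]
    exact add_mem (pow_mem hy q) hy
  rwa [P.mem_ring_iff, map_pow, pow_le_one_iff q.succ_ne_zero, ← P.mem_ring_iff] at h

theorem valuation_y_mul_aeval_le_of_y_notMem (hy : y K q ∉ P.ring) (hm : 2 ≤ m)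
    (hmq : m ≤ q + 1) (hg : g.totalDegree ≤ m - 2) :
    P.valuation (y K q * MvPolynomial.aeval ![x K q, y K q] g) ≤ P.valuation (x K q) ^ m := by
  have hinv := (P.valuation_inv_lt_one_iff (y_ne_zero K q)).2 hy
  have hy0 : 0 < P.valuation (y K q) := P.valuation.pos_iff.2 (y_ne_zero K q)
  have hxy : P.valuation (x K q) ≤ P.valuation (y K q) := by
    have h := valuation_lt_one_of_pow_add_self_eq _ (two_le K q) (equation_at_infinity K q) hinv
    rw [map_div₀, div_lt_one₀ hy0] at h
    exact h.le
  have hone : 1 ≤ P.valuation (y K q) := by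
    rw [P.mem_ring_iff, not_le] at hy
    exact hy.le
  have hle : ∀ i, P.valuation (![x K q, y K q] i) ≤ P.valuation (y K q) :=
    Fin.forall_fin_two.2 ⟨hxy, le_rfl⟩
  calc P.valuation (y K q * MvPolynomial.aeval ![x K q, y K q] g)
      ≤ P.valuation (y K q) * P.valuation (y K q) ^ (m - 2) := by
        rw [map_mul]
        gcongr
        exact P.valuation_aeval_le hle hone hg
    _ = P.valuation (y K q)⁻¹ * P.valuation (y K q) ^ m := by
        rw [map_inv₀, ← pow_succ', eq_inv_mul_iff_mul_eq₀ hy0.ne', ← pow_succ']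
        congr 1
        omega
    _ ≤ P.valuation (x K q / y K q) ^ m * P.valuation (y K q) ^ m := by
        gcongr
        exact valuation_le_pow_of_pow_add_self_eq _ (two_le K q) (equation_at_infinity K q) hinv hmq
    _ = P.valuation (x K q) ^ m := by
        rw [← mul_pow, ← map_mul, div_mul_cancel₀ _ (y_ne_zero K q)]

theorem valuation_y_mul_aeval_le_of_y_mem (hy : y K q ∈ P.ring)
    (hP : ∀ Q ∈ chordPoints K q, P ≠ Q.place) (hmq : m ≤ q + 1) :
    P.valuation (y K q * MvPolynomial.aeval ![x K q, y K q] g) ≤ P.valuation (x K q) ^ m := by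
  have hx := x_mem_of_y_mem hy
  have hg : MvPolynomial.aeval ![x K q, y K q] g ∈ P.ring :=
    P.aeval_mem (Fin.forall_fin_two.2 ⟨hx, hy⟩) g
  rcases (P.mem_ring_iff.1 hx).lt_or_eq with hlt | heq
  · obtain ⟨Q, ha, rfl⟩ := exists_eq_place_of_valuation_x_lt_one hlt
    have hb : Q.b = 0 := by
      by_contra hb
      exact hP Q ((mem_chordPoints K q).2 ⟨ha, hb⟩) rfl
    have hy : Q.place.valuation (y K q) < 1 := by
      rw [y, Q.valuation_algebraMap_lt_one_iff, Q.eval_yR, hb]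
    rw [map_mul]
    exact (mul_le_of_le_one_right' (Q.place.mem_ring_iff.1 hg)).trans
      (valuation_le_pow_of_pow_add_self_eq _ (two_le K q) (equation_x_y K q) hy hmq)
  · rw [heq, one_pow, ← P.mem_ring_iff]
    exact mul_mem hy hg

theorem mem_riemannRochSpace_of_aeval (hm : 2 ≤ m) (hmq : m ≤ q + 1)
    (hg : g.totalDegree ≤ m - 2) (ε : K) :
    (y K q * MvPolynomial.aeval ![x K q, y K q] g +
      algebraMap K (FunctionField K q) ε * x K q ^ m) / x K q ^ m ∈
      riemannRochSpace (chordDivisor K q m) := by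
  have hx0 := pow_ne_zero m (x_ne_zero K q)
  rw [mem_riemannRochSpace_chordDivisor]
  refine ⟨fun Q _ => ?_, fun P hP => ?_⟩
  · have hx : x K q ∈ Q.place.ring := Q.algebraMap_mem_place_ring _
    have hy : y K q ∈ Q.place.ring := Q.algebraMap_mem_place_ring _
    rw [div_mul_cancel₀ _ hx0]
    exact add_mem (mul_mem hy (Q.place.aeval_mem (Fin.forall_fin_two.2 ⟨hx, hy⟩) g))
      (mul_mem (Q.place.algebraMap_mem ε) (pow_mem hx m))
  · rw [add_div, mul_div_cancel_right₀ _ hx0]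
    refine add_mem ?_ (P.algebraMap_mem ε)
    rw [P.mem_ring_iff, map_div₀, map_pow,
      div_le_one₀ (pow_pos (P.valuation.pos_iff.2 (x_ne_zero K q)) m)]
    by_cases hy : y K q ∈ P.ring
    · exact valuation_y_mul_aeval_le_of_y_mem hy hP hmq
    · exact valuation_y_mul_aeval_le_of_y_notMem hy hm hmq hg

theorem exists_aeval_of_mem_riemannRochSpace {f : FunctionField K q}
    (hf : f ∈ riemannRochSpace (chordDivisor K q m)) : ∃ p : MvPolynomial (Fin 2) K,
      f * x K q ^ m = MvPolynomial.aeval ![x K q, y K q] p ∧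
      ∀ d ∈ p.support, d 1 = 0 ∧ d 0 = m ∨ 1 ≤ d 1 ∧ d 0 + d 1 + 1 ≤ m := by
  rw [mem_riemannRochSpace_chordDivisor] at hf
  obtain ⟨hchord, hother⟩ := hf
  obtain ⟨r, hr⟩ := exists_algebraMap_eq_of_forall_place (f := f * x K q ^ m) fun P hx _ => by
    by_cases h : ∀ Q ∈ chordPoints K q, P ≠ Q.place
    · exact mul_mem (hother P h) (pow_mem hx m)
    · push Not at h
      obtain ⟨Q, hQ, rfl⟩ := h
      exact hchord Q hQ
  obtain ⟨p, hp, rfl⟩ := exists_aeval_eq K q r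
  rw [algebraMap_aeval] at hr
  have horigin : f ∈ (origin K q).place.ring := hother _ fun Q hQ h =>
    ((mem_chordPoints K q).1 (AffinePoint.place_injective h ▸ hQ)).2 rfl
  have hinfinity : f ∈ (infinityPlace K q).ring := hother _ fun Q _ h =>
    y_notMem_infinityPlace_ring K q (h ▸ Q.algebraMap_mem_place_ring (yR K q))
  refine ⟨p, hr.symm, fun d hd => ?_⟩
  have hlower := le_of_mem_origin_ring hp hr.symm horigin hd
  have hupper := le_of_mem_infinityPlace_ring hp hr.symm hinfinity hd
  have hq := two_le K q
  rcases Nat.eq_zero_or_pos (d 1) with h1 | h1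
  · rw [h1, zero_mul, add_zero] at hlower hupper
    exact Or.inl ⟨h1, (Nat.le_of_mul_le_mul_right hupper (by omega)).antisymm hlower⟩
  · have hlt : (d 0 + d 1) * q < m * q := by linarith
    exact Or.inr ⟨h1, Nat.lt_of_mul_lt_mul_right hlt⟩

variable (K q) in
/-- The map `(g, ε) ↦ (y g(x, y) + ε x ^ m) / x ^ m`, whose image is the Riemann–Roch space of the
chord divisor. -/
def parametrization (m : ℕ) :
    MvPolynomial.restrictTotalDegree (Fin 2) K (m - 2) × K →ₗ[K] FunctionField K q :=
  (LinearMap.mulLeft K (y K q / x K q ^ m) ∘ₗ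
    (MvPolynomial.aeval ![x K q, y K q]).toLinearMap ∘ₗ Submodule.subtype _).coprod
    (Algebra.linearMap K (FunctionField K q))

theorem parametrization_apply (g : MvPolynomial.restrictTotalDegree (Fin 2) K (m - 2)) (ε : K) :
    parametrization K q m (g, ε) = (y K q * MvPolynomial.aeval ![x K q, y K q] g.1 +
      algebraMap K (FunctionField K q) ε * x K q ^ m) / x K q ^ m := by
  rw [add_div, mul_div_cancel_right₀ _ (pow_ne_zero m (x_ne_zero K q)), mul_div_right_comm]
  rfl

theorem mem_range_parametrization {f : FunctionField K q} :
    f ∈ LinearMap.range (parametrization K q m) ↔ ∃ (g : MvPolynomial (Fin 2) K) (ε : K),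
      g.totalDegree ≤ m - 2 ∧ f = (y K q * MvPolynomial.aeval ![x K q, y K q] g +
        algebraMap K (FunctionField K q) ε * x K q ^ m) / x K q ^ m := by
  constructor
  · rintro ⟨⟨g, ε⟩, rfl⟩
    exact ⟨g, ε, (MvPolynomial.mem_restrictTotalDegree _ _ _).1 g.2, parametrization_apply g ε⟩
  · rintro ⟨g, ε, hg, rfl⟩
    exact ⟨(⟨g, (MvPolynomial.mem_restrictTotalDegree _ _ _).2 hg⟩, ε), parametrization_apply _ ε⟩

theorem aeval_monomial_div_mem_range_parametrization {d : Fin 2 →₀ ℕ}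
    (hd : d 1 = 0 ∧ d 0 = m ∨ 1 ≤ d 1 ∧ d 0 + d 1 + 1 ≤ m) (c : K) :
    MvPolynomial.aeval ![x K q, y K q] (MvPolynomial.monomial d c) / x K q ^ m ∈
      LinearMap.range (parametrization K q m) := by
  have haeval (e : Fin 2 →₀ ℕ) : MvPolynomial.aeval ![x K q, y K q] (MvPolynomial.monomial e c) =
      algebraMap K _ c * (x K q ^ e 0 * y K q ^ e 1) := by
    rw [MvPolynomial.aeval_monomial, Finsupp.prod_fintype _ _ (by simp), Fin.prod_univ_two]
    simp
  rw [mem_range_parametrization, haeval]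
  rcases hd with ⟨h1, h0⟩ | ⟨h1, hsum⟩
  · exact ⟨0, c, by simp, by simp [h0, h1]⟩
  · obtain ⟨e, rfl⟩ : ∃ e, d = e + Finsupp.single 1 1 :=
      ⟨_, (tsub_add_cancel_of_le (Finsupp.single_le_iff.2 h1)).symm⟩
    have he0 : (e + Finsupp.single 1 1 : Fin 2 →₀ ℕ) 0 = e 0 := by simp
    have he1 : (e + Finsupp.single 1 1 : Fin 2 →₀ ℕ) 1 = e 1 + 1 := by simp
    rw [he0, he1] at hsum ⊢
    refine ⟨MvPolynomial.monomial e c, 0, ?_, ?_⟩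
    · refine (MvPolynomial.totalDegree_monomial_le _ _).trans ?_
      rw [Finsupp.sum_fintype _ _ fun _ => rfl, Fin.sum_univ_two]
      change e 0 + e 1 ≤ m - 2
      omega
    · rw [haeval, (algebraMap K _).map_zero]
      ring

theorem range_parametrization (hm : 2 ≤ m) (hmq : m ≤ q + 1) :
    LinearMap.range (parametrization K q m) = riemannRochSpace (chordDivisor K q m) := by
  refine le_antisymm (fun f hf => ?_) fun f hf => ?_
  · obtain ⟨g, ε, hg, rfl⟩ := mem_range_parametrization.1 hf
    exact mem_riemannRochSpace_of_aeval hm hmq hg ε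
  · obtain ⟨p, hfp, hp⟩ := exists_aeval_of_mem_riemannRochSpace hf
    rw [eq_div_of_mul_eq (pow_ne_zero m (x_ne_zero K q)) hfp, p.as_sum, map_sum, Finset.sum_div]
    exact Submodule.sum_mem _ fun d hd =>
      aeval_monomial_div_mem_range_parametrization (hp d hd) _

theorem parametrization_injective (hm : 2 ≤ m) (hmq : m ≤ q) :
    Function.Injective (parametrization K q m) := by
  refine (injective_iff_map_eq_zero _).2 ?_
  rintro ⟨⟨g, hg⟩, ε⟩ h
  rw [MvPolynomial.mem_restrictTotalDegree] at hg
  rw [parametrization_apply, div_eq_zero_iff, or_iff_left (pow_ne_zero m (x_ne_zero K q))] at h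
  let p : MvPolynomial (Fin 2) K :=
    MvPolynomial.X 1 * g + MvPolynomial.C ε * MvPolynomial.X 0 ^ m
  have hdeg : p.totalDegree ≤ m := by
    refine (MvPolynomial.totalDegree_add _ _).trans (max_le ?_ ?_) <;>
      refine (MvPolynomial.totalDegree_mul _ _).trans ?_
    · rw [MvPolynomial.totalDegree_X]
      omega
    · rw [MvPolynomial.totalDegree_C, MvPolynomial.totalDegree_X_pow, zero_add]
  have hp : p = 0 := eq_zero_of_aeval_eq_zero
    ((MvPolynomial.degreeOf_le_totalDegree p 0).trans (hdeg.trans hmq)) (by simpa [p] using h)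
  have hε : ε = 0 := by
    have hcoeff : p.coeff (Finsupp.single 0 m) = 0 := by rw [hp, MvPolynomial.coeff_zero]
    simpa [p, MvPolynomial.coeff_X_mul', MvPolynomial.C_mul_X_pow_eq_monomial] using hcoeff
  have hg0 : g = 0 := by simpa [p, hε] using hp
  subst hε hg0
  rfl

theorem coe_riemannRochSpace_chordDivisor (hm : 2 ≤ m) (hmq : m ≤ q + 1) :
    (riemannRochSpace (chordDivisor K q m) : Set (FunctionField K q)) =
      {f | ∃ (g : MvPolynomial (Fin 2) K) (ε : K), g.totalDegree ≤ m - 2 ∧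
        f = (y K q * MvPolynomial.aeval ![x K q, y K q] g +
          algebraMap K (FunctionField K q) ε * x K q ^ m) / x K q ^ m} := by
  rw [← range_parametrization hm hmq]
  exact Set.ext fun f => mem_range_parametrization

theorem finrank_riemannRochSpace_chordDivisor (hm : 2 ≤ m) (hmq : m ≤ q) :
    (Module.finrank K (riemannRochSpace (chordDivisor K q m)) : ℚ) =
      1 / 2 * m * (m - 1) + 1 := by
  rw [← range_parametrization hm (by omega),
    LinearMap.finrank_range_of_inj (parametrization_injective hm hmq), Module.finrank_prod,
    finrank_restrictTotalDegree, Module.finrank_self, Fintype.card_fin, Nat.sub_add_cancel hm,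
    Nat.cast_add, Nat.cast_choose_two, Nat.cast_one]
  ring

end

end Hermitian

end

theorem proposition2_general (K : Type*) [Field K] [Finite K] (q : ℕ) [Fact (Nat.card K = q ^ 2)]
    (m : ℕ) (hm : 2 ≤ m) (hmq : m ≤ q) :
    (Hermitian.chordPoints K q).card = q - 1 ∧
    (riemannRochSpace (Hermitian.chordDivisor K q m) : Set (Hermitian.FunctionField K q)) =
      {f | ∃ (g : MvPolynomial (Fin 2) K) (ε : K), g.totalDegree ≤ m - 2 ∧
        f = (Hermitian.y K q * MvPolynomial.aeval ![Hermitian.x K q, Hermitian.y K q] g +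
          algebraMap K (Hermitian.FunctionField K q) ε * Hermitian.x K q ^ m) /
            Hermitian.x K q ^ m} ∧
    (Hermitian.chordDivisor K q m).degree = m * ((q : ℤ) - 1) ∧
    (Module.finrank K (riemannRochSpace (Hermitian.chordDivisor K q m)) : ℚ) =
      1 / 2 * m * (m - 1) + 1 :=
  ⟨Hermitian.card_chordPoints K q,
    Hermitian.coe_riemannRochSpace_chordDivisor hm (hmq.trans q.le_succ),
    Hermitian.degree_chordDivisor K q m, Hermitian.finrank_riemannRochSpace_chordDivisor hm hmq⟩

theorem proposition2 (K : Type*) [Field K] [Finite K] (q : ℕ) [Fact (Nat.card K = q ^ 2)]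
    (m : ℕ) (hm : 2 ≤ m) (hmq : m ≤ q - 1) :
    (Hermitian.chordPoints K q).card = q - 1 ∧
    (riemannRochSpace (Hermitian.chordDivisor K q m) : Set (Hermitian.FunctionField K q)) =
      {f | ∃ (g : MvPolynomial (Fin 2) K) (ε : K), g.totalDegree ≤ m - 2 ∧
        f = (Hermitian.y K q * MvPolynomial.aeval ![Hermitian.x K q, Hermitian.y K q] g +
          algebraMap K (Hermitian.FunctionField K q) ε * Hermitian.x K q ^ m) / Hermitian.x K q ^ m} ∧
    (Hermitian.chordDivisor K q m).degree = m * ((q : ℤ) - 1) ∧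
    (Module.finrank K (riemannRochSpace (Hermitian.chordDivisor K q m)) : ℚ) =
      1 / 2 * m * (m - 1) + 1 :=
  proposition2_general K q m hm (hmq.trans q.pred_le)
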